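/- Let $d\ge 1$ and let $\{\psi_\lambda\}_{\lambda\in\Lambda}$ be an (inhomogeneous) orthonormal wavelet basis of $L_2=L_2(\mathbb R^d)$ consisting of real Schwartz functions; $|\lambda|$ denotes the level of $\lambda$. For $s\in\mathbb R$ and $p>0$ let $B^s_p$ be the space of real tempered distributions $u$ on $\mathbb R^d$ with $$\|u\|_{B^s_p}^p:=\sum_{\lambda\in\Lambda}2^{p(s+d(\frac12-\frac1p))|\lambda|}\,|\langle u,\psi_\lambda\rangle|^p<\infty ,$$ and put $\|u\|_{B^s_p}=\infty$ for $u\notin B^s_p$. Let $H^s:=B^s_2$. Let $\eta>0$ and $0<\varepsilon<\eta/3$, and let $F:H^{-\eta}\to L_2$ be linear and continuous with $\operatorname{rg}F^*=H^\eta$ (where $F^*w$, $w\in L_2$, is regarded as the tempered distribution $\varphi\mapsto\langle w,F\varphi\rangle_{L_2}$). For $u^\dagger\in H^{-\eta}$ and a space $\mathcal B_R=B^{s_R}_{p_R}$, let $u^{\alpha,\delta}$ denote any minimizer over $H^{-\eta}$ of $$T_\alpha(u)=\|Fu-v^\delta\|_{L_2}^2+\alpha\,\|u\|_{\mathcal B_R}^{p_R},\qquad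 \|v^\delta-Fu^\dagger\|_{L_2}\le\delta,$$ with parameter rule $\alpha\asymp\delta$. For a source condition $u^\dagger\in B^{s_S}_{p_S}$ and $\operatorname{rg}F^*=B^{s_G}_{p_G}$ consider the parameter choice $$p_R=\frac{p_S+p_G}{p_G},\qquad s_R\le\frac{p_Ss_S-p_Gs_G}{p_S+p_G},\qquad \sigma=s_R+d\Big(\frac12-\frac1{p_R}\Big). \tag{$*$}$$ 1. (Loose source condition.) For $\mathcal B_S=H^\eta$ (which is continuously embedded in $H^{-\eta}$) the choice $(*)$, with $s_G=\eta$ and $p_G=2$, gives $p_R=2$ and the maximal value $s_R=0$, i.e. $\mathcal B_R=H^0=L_2$ (with equal norms), and the largest $\sigma$ allowed by $(*)$ is $\sigma=0$. If $u^\dagger\in H^\eta$, then for this penalty $$\|u^{\alpha,\delta}-u^\dagger\|_{L_2}=\mathcal O(\sqrt\delta)\qquad(\delta\to0).$$ 2. (Tighter source condition.) The space $B_1^{\eta+d/2+3\varepsilon}$ is continuously embedded in $H^\eta$ and is a proper subspace of it. For $\mathcal B_S=B_1^{\eta+d/2+3\varepsilon}$ the choice $(*)$, with $s_G=\eta$ and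 $p_G=2$, gives $p_R=\frac32$ and the maximal value $s_R=-\frac\eta3+\varepsilon+\frac d6$, i.e. $\mathcal B_R=B_{3/2}^{-\eta/3+\varepsilon+d/6}$, and the largest $\sigma$ allowed by $(*)$ is $\sigma=-\frac\eta3+\varepsilon$. If $u^\dagger\in B_1^{\eta+d/2+3\varepsilon}$, then for this penalty $$\|u^{\alpha,\delta}-u^\dagger\|_{H^{-\eta/3+\varepsilon}}=\mathcal O(\sqrt\delta)\qquad(\delta\to0).$$ 3. $L_2$ is continuously embedded in $H^{-\eta/3+\varepsilon}$ and is a proper subspace of it. So with the choice $(*)$ the tighter source condition is guaranteed a rate only in a strictly larger space, i.e. in a weaker norm, than the loose source condition. -/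

import Mathlib

open MeasureTheory
open scoped ENNReal NNReal SchwartzMap

noncomputable section

namespace BesovTikhonov

/-- The Euclidean space `ℝ^d`. -/
abbrev Pt (d : ℕ) : Type := EuclideanSpace ℝ (Fin d)

/-- The real Hilbert space `L_2(ℝ^d)`. -/
abbrev L2 (d : ℕ) : Type := Lp ℝ 2 (volume : Measure (Pt d))

/-- Real tempered distributions on `ℝ^d`: continuous linear functionals on real-valued Schwartz
functions. -/
abbrev Distr (d : ℕ) : Type := 𝓢(Pt d, ℝ) →L[ℝ] ℝ

/-- The tempered distribution `χ ↦ ∫ f χ` of a function `f ∈ L_2`. -/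
def ofL2 {d : ℕ} (f : L2 d) : Distr d :=
  (innerSL ℝ f).comp (SchwartzMap.toLpCLM ℝ ℝ 2 (volume : Measure (Pt d)))

/-- The `L_2` norm of a tempered distribution; it is `∞` if the distribution is not (given by) an
`L_2` function. -/
def l2Norm {d : ℕ} (u : Distr d) : ℝ≥0∞ :=
  ⨅ (f : L2 d) (_ : u = ofL2 f), ‖f‖ₑ

/-! ### Wavelets -/

/-- Indices `λ` of an inhomogeneous wavelet basis of `L_2(ℝ^d)`: translates `k ∈ ℤ^d` of the father
wavelet, and dilation levels `j ≥ 0`, types `1, …, 2^d - 1` and translates `k ∈ ℤ^d` of the mother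
wavelets. -/
abbrev Index (d : ℕ) : Type := (Fin d → ℤ) ⊕ (ℕ × Fin (2 ^ d - 1) × (Fin d → ℤ))

/-- The level `|λ|`. -/
def Index.level {d : ℕ} : Index d → ℕ
  | Sum.inl _ => 0
  | Sum.inr l => l.1

/-- The integer point `k ∈ ℤ^d` as a point of `ℝ^d`. -/
def intPt {d : ℕ} (k : Fin d → ℤ) : Pt d := WithLp.toLp 2 fun i => (k i : ℝ)

lemma antilipschitz_dilate {d : ℕ} (j : ℕ) (a : Pt d) :
    AntilipschitzWith 1 fun x : Pt d => (2 : ℝ) ^ j • x - a := by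
  apply AntilipschitzWith.of_le_mul_dist
  intro x y
  have h : (1 : ℝ) ≤ 2 ^ j := one_le_pow₀ (by norm_num)
  rw [NNReal.coe_one, one_mul, dist_sub_right, dist_smul₀, norm_pow, Real.norm_ofNat]
  exact le_mul_of_one_le_left dist_nonneg h

/-- The function `x ↦ 2^{jd/2} f(2^j x - k)`. -/
def dilate {d : ℕ} (f : 𝓢(Pt d, ℝ)) (j : ℕ) (k : Fin d → ℤ) : 𝓢(Pt d, ℝ) :=
  ((2 : ℝ) ^ ((j : ℝ) * d / 2)) •
    SchwartzMap.compCLMOfAntilipschitz ℝ (g := fun x : Pt d => (2 : ℝ) ^ j • x - intPt k)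
      (by fun_prop) (antilipschitz_dilate j (intPt k)) f

lemma dilate_apply {d : ℕ} (f : 𝓢(Pt d, ℝ)) (j : ℕ) (k : Fin d → ℤ) (x : Pt d) :
    dilate f j k x = (2 : ℝ) ^ ((j : ℝ) * d / 2) * f ((2 : ℝ) ^ j • x - intPt k) := rfl

/-- The family `ψ_λ` generated by a father wavelet `φ` and mother wavelets `ψ_i`. -/
def waveletFamily {d : ℕ} (father : 𝓢(Pt d, ℝ)) (mother : Fin (2 ^ d - 1) → 𝓢(Pt d, ℝ)) :
    Index d → 𝓢(Pt d, ℝ)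
  | Sum.inl k => dilate father 0 k
  | Sum.inr (j, i, k) => dilate (mother i) j k

/-- An orthonormal wavelet basis of `L_2(ℝ^d)` consisting of Schwartz functions
(for instance the Meyer wavelets). -/
structure WaveletSystem (d : ℕ) where
  father : 𝓢(Pt d, ℝ)
  mother : Fin (2 ^ d - 1) → 𝓢(Pt d, ℝ)
  orthonormal : Orthonormal ℝ fun l : Index d => ((waveletFamily father mother l).toLp 2 : L2 d)
  complete : ⊤ ≤ (Submodule.span ℝ (Set.range fun l : Index d =>
    ((waveletFamily father mother l).toLp 2 : L2 d))).topologicalClosure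

/-- The wavelet `ψ_λ`. -/
def WaveletSystem.fn {d : ℕ} (W : WaveletSystem d) (l : Index d) : 𝓢(Pt d, ℝ) :=
  waveletFamily W.father W.mother l

/-! ### Besov spaces -/

/-- `‖u‖_{B^s_p}^p = ∑_λ 2^{p (s + d (1/2 - 1/p)) |λ|} |u_λ|^p`, where `u_λ = ⟨u, ψ_λ⟩`. -/
def besovPow {d : ℕ} (W : WaveletSystem d) (s p : ℝ) (u : Distr d) : ℝ≥0∞ :=
  ∑' l : Index d, ENNReal.ofReal
    ((2 : ℝ) ^ (p * (s + d * (1 / 2 - 1 / p)) * (l.level : ℝ)) * |u (W.fn l)| ^ p)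

/-- `‖u‖_{B^s_p}`. -/
def besovNorm {d : ℕ} (W : WaveletSystem d) (s p : ℝ) (u : Distr d) : ℝ≥0∞ :=
  besovPow W s p u ^ (1 / p)

/-- `u = ∑_λ u_λ ψ_λ` in the sense of tempered distributions. (Every tempered distribution has this
expansion, because the wavelet expansion of a Schwartz function converges in the Schwartz space.) -/
def HasWaveletExpansion {d : ℕ} (W : WaveletSystem d) (u : Distr d) : Prop :=
  ∀ χ : 𝓢(Pt d, ℝ),
    HasSum (fun l : Index d => u (W.fn l) * inner ℝ ((W.fn l).toLp 2 : L2 d) (χ.toLp 2)) (u χ)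

lemma abs_add_rpow_le {p : ℝ} (hp : 0 < p) (a b : ℝ) :
    |a + b| ^ p ≤ 2 ^ p * (|a| ^ p + |b| ^ p) := by
  have ha := abs_nonneg a
  have hb := abs_nonneg b
  have h1 : |a + b| ≤ 2 * max |a| |b| := by
    have := abs_add_le a b
    have := le_max_left |a| |b|
    have := le_max_right |a| |b|
    linarith
  calc |a + b| ^ p ≤ (2 * max |a| |b|) ^ p :=
        Real.rpow_le_rpow (abs_nonneg _) h1 hp.le
    _ = 2 ^ p * (max |a| |b|) ^ p := Real.mul_rpow (by norm_num) (le_max_of_le_left ha)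
    _ ≤ 2 ^ p * (|a| ^ p + |b| ^ p) := by
        gcongr
        rcases max_choice |a| |b| with h | h <;> rw [h]
        · exact le_add_of_nonneg_right (by positivity)
        · exact le_add_of_nonneg_left (by positivity)

/-- The Besov space `B^s_p = B^s_{p,p}(ℝ^d)`. -/
def besov {d : ℕ} (W : WaveletSystem d) (s p : ℝ) (hp : 0 < p) : Submodule ℝ (Distr d) where
  carrier := {u | HasWaveletExpansion W u ∧ besovPow W s p u < ∞}
  zero_mem' := by
    refine ⟨fun χ => ?_, ?_⟩
    · simp
    · simp [besovPow, Real.zero_rpow hp.ne']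
  add_mem' := by
    rintro u v ⟨hu, hu'⟩ ⟨hv, hv'⟩
    refine ⟨fun χ => ?_, ?_⟩
    · simpa [add_mul] using (hu χ).add (hv χ)
    · have h : besovPow W s p (u + v) ≤
          ENNReal.ofReal (2 ^ p) * (besovPow W s p u + besovPow W s p v) := by
        unfold besovPow
        rw [← ENNReal.tsum_add, ← ENNReal.tsum_mul_left]
        refine ENNReal.tsum_le_tsum fun l => ?_
        rw [← ENNReal.ofReal_add (by positivity) (by positivity),
          ← ENNReal.ofReal_mul (by positivity)]
        refine ENNReal.ofReal_le_ofReal ?_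
        rw [← mul_add, mul_left_comm, add_apply]
        gcongr
        exact abs_add_rpow_le hp _ _
      exact h.trans_lt (ENNReal.mul_lt_top ENNReal.ofReal_lt_top (ENNReal.add_lt_top.2 ⟨hu', hv'⟩))
  smul_mem' := by
    rintro c u ⟨hu, hu'⟩
    refine ⟨fun χ => ?_, ?_⟩
    · simpa [mul_assoc] using (hu χ).mul_left c
    · have h : besovPow W s p (c • u) = ENNReal.ofReal (|c| ^ p) * besovPow W s p u := by
        unfold besovPow
        rw [← ENNReal.tsum_mul_left]
        refine tsum_congr fun l => ?_
        rw [← ENNReal.ofReal_mul (by positivity)]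
        congr 1
        simp only [smul_apply, smul_eq_mul, abs_mul]
        rw [Real.mul_rpow (abs_nonneg _) (abs_nonneg _)]
        ring
      change besovPow W s p (c • u) < ∞
      rw [h]
      exact ENNReal.mul_lt_top ENNReal.ofReal_lt_top hu'

/-- The Sobolev space `H^s = B^s_2`. -/
abbrev sobolev {d : ℕ} (W : WaveletSystem d) (s : ℝ) : Submodule ℝ (Distr d) :=
  besov W s 2 two_pos

/-- `B^{s₁}_{p₁} ⊂ B^{s₂}_{p₂}` with continuous embedding. -/
def ContEmbeds {d : ℕ} (W : WaveletSystem d) (s₁ p₁ : ℝ) (hp₁ : 0 < p₁) (s₂ p₂ : ℝ)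
    (hp₂ : 0 < p₂) : Prop :=
  besov W s₁ p₁ hp₁ ≤ besov W s₂ p₂ hp₂ ∧
    ∃ C : ℝ≥0, ∀ u ∈ besov W s₁ p₁ hp₁, besovNorm W s₂ p₂ u ≤ C * besovNorm W s₁ p₁ u

/-- Every `L_2` function belongs to `H^s` for `s ≤ 0`. In particular the domains `H^{-η}` contain
all Schwartz functions. -/
lemma ofL2_mem_sobolev {d : ℕ} (W : WaveletSystem d) {s : ℝ} (hs : s ≤ 0) (f : L2 d) :
    ofL2 f ∈ sobolev W s := by
  have e : ∀ χ : 𝓢(Pt d, ℝ), ofL2 f χ = inner ℝ f (χ.toLp 2 : L2 d) := fun χ => rfl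
  refine ⟨fun χ => ?_, ?_⟩
  · have h := (HilbertBasis.mk W.orthonormal W.complete).hasSum_inner_mul_inner f (χ.toLp 2)
    simp only [HilbertBasis.coe_mk] at h
    exact h
  · have hS := W.orthonormal.inner_products_summable f
    refine lt_of_le_of_lt (ENNReal.tsum_le_tsum fun l => ENNReal.ofReal_le_ofReal ?_)
      hS.tsum_ofReal_lt_top
    rw [e, real_inner_comm, Real.norm_eq_abs, Real.rpow_two]
    refine mul_le_of_le_one_left (by positivity) ?_
    refine Real.rpow_le_one_of_one_le_of_nonpos (by norm_num) ?_
    have : (0 : ℝ) ≤ l.level := Nat.cast_nonneg _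
    have h2 : (2 : ℝ) * (s + d * (1 / 2 - 1 / 2)) ≤ 0 := by linarith
    exact mul_nonpos_of_nonpos_of_nonneg h2 this

/-! ### Tikhonov regularization -/

/-- The range of the adjoint `F^*` of a bounded operator `F : 𝓑_D → L_2`, as a set of tempered
distributions: `F^* w` is the distribution `φ ↦ ⟨w, F φ⟩_{L_2}`. -/
def adjointRange {d : ℕ} {D : Submodule ℝ (Distr d)} (F : D →ₗ[ℝ] L2 d) : Set (Distr d) :=
  {T | ∃ w : L2 d, ∀ φ : 𝓢(Pt d, ℝ), ∀ u : D, (u : Distr d) = ofL2 (φ.toLp 2) →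
    T φ = inner ℝ w (F u)}

/-- The Tikhonov functional `T_α(u) = ‖F u - v‖² + α ‖u‖_{B^{s_R}_{p_R}}^{p_R}` on `𝓑_D`. It is `∞`
for `u ∉ B^{s_R}_{p_R}`. -/
def tikhonov {d : ℕ} (W : WaveletSystem d) {D : Submodule ℝ (Distr d)} (F : D →ₗ[ℝ] L2 d)
    (sR pR α : ℝ) (v : L2 d) (u : D) : ℝ≥0∞ :=
  ENNReal.ofReal (‖F u - v‖ ^ 2) + ENNReal.ofReal α * besovPow W sR pR (u : Distr d)

/-- With the penalty `‖·‖_{B^{s_R}_{p_R}}^{p_R}` and a parameter rule `α ≍ δ`, all minimizers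
`u^{α,δ}` of the Tikhonov functional for data `v^δ` with `‖v^δ - F u†‖ ≤ δ` satisfy
`N (u^{α,δ} - u†) = O(√δ)` as `δ → 0`. -/
def ConvergesAtRateSqrt {d : ℕ} (W : WaveletSystem d) {D : Submodule ℝ (Distr d)}
    (F : D →ₗ[ℝ] L2 d) (sR pR : ℝ) (N : Distr d → ℝ≥0∞) (u₀ : D) : Prop :=
  ∀ c C : ℝ, 0 < c → ∃ K δ₀ : ℝ, 0 < δ₀ ∧
    ∀ δ : ℝ, 0 < δ → δ ≤ δ₀ → ∀ α : ℝ, c * δ ≤ α → α ≤ C * δ →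
      ∀ v : L2 d, ‖v - F u₀‖ ≤ δ →
        ∀ u : D, (∀ u' : D, tikhonov W F sR pR α v u ≤ tikhonov W F sR pR α v u') →
          N ((u : Distr d) - (u₀ : Distr d)) ≤ ENNReal.ofReal (K * Real.sqrt δ)

/-! ### The parameters of the general rate theorem -/

/-- The integrability `p_R = (p_S + p_G) / p_G` of the penalty. -/
def penaltyIntegrability (pS pG : ℝ) : ℝ := (pS + pG) / pG

/-- The upper bound `(p_S s_S - p_G s_G) / (p_S + p_G)` for the smoothness `s_R` of the penalty. -/
def maxPenaltySmoothness (sS pS sG pG : ℝ) : ℝ := (pS * sS - pG * sG) / (pS + pG)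

/-- The smoothness `σ = s_R + d (1/2 - 1/p_R)` of the Sobolev space `H^σ` of the rate. -/
def rateSmoothness (d : ℕ) (sR pR : ℝ) : ℝ := sR + d * (1 / 2 - 1 / pR)

/-- All smoothness indices `σ` in which the source condition `u† ∈ B^{s_S}_{p_S}` and
`rg F^* = B^{s_G}_{p_G}` give a rate, when `s_R` runs through its admissible values. -/
def guaranteedSmoothness (d : ℕ) (sS pS sG pG : ℝ) : Set ℝ :=
  {σ | ∃ sR ≤ maxPenaltySmoothness sS pS sG pG,
    σ = rateSmoothness d sR (penaltyIntegrability pS pG)}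

end BesovTikhonov

end

/-!
Comparing a minimizer with `u†` and completing the square shows that, if the derivative `ξ` of the
penalty at `u†` equals `F^* w`, then the Bregman distance of the minimizer to `u†` is `O(δ)`.
In wavelet coordinates the penalty is an `ℓ^p` norm to the power `p`, and `|x|^p` with `1 < p ≤ 2`
is uniformly convex on bounded sets; as the minimizers are bounded in `B^{s_R}_{p_R}`, the Bregman
distance dominates the square of the norm of `H^σ`. The choice `(*)` of the penalty is the one for
which `u† ∈ B^{s_S}_{p_S}` forces `ξ ∈ B^{s_G}_{p_G}`.

The embeddings are strict because the lacunary series `∑_j 2^{-τj} ψ_{(j,0)}` lies in exactly those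
`B^s_p` with `s + d (1/2 - 1/p) < τ`.
-/

noncomputable section

namespace BesovTikhonov

variable {d : ℕ} {W : WaveletSystem d}

/-! ### Scaled wavelet coefficients -/

/-- The weight `2^{τ|λ|}` that turns wavelet coefficients into a plain `ℓ^p` sequence. -/
def levelWeight (τ : ℝ) (l : Index d) : ℝ := (2 : ℝ) ^ (τ * (l.level : ℝ))

lemma levelWeight_pos (τ : ℝ) (l : Index d) : 0 < levelWeight τ l :=
  Real.rpow_pos_of_pos two_pos _

lemma levelWeight_add (σ τ : ℝ) (l : Index d) :
    levelWeight (σ + τ) l = levelWeight σ l * levelWeight τ l := by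
  rw [levelWeight, add_mul, Real.rpow_add two_pos, levelWeight, levelWeight]

lemma levelWeight_rpow (τ q : ℝ) (l : Index d) : levelWeight τ l ^ q = levelWeight (q * τ) l := by
  rw [levelWeight, ← Real.rpow_mul zero_le_two, levelWeight]
  ring_nf

lemma levelWeight_mono {σ τ : ℝ} (h : σ ≤ τ) (l : Index d) : levelWeight σ l ≤ levelWeight τ l :=
  Real.rpow_le_rpow_of_exponent_le one_le_two (by gcongr)

lemma one_le_levelWeight {τ : ℝ} (h : 0 ≤ τ) (l : Index d) : 1 ≤ levelWeight τ l :=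
  Real.one_le_rpow one_le_two (by positivity)

/-- The coefficients `2^{τ|λ|} ⟨u, ψ_λ⟩`. For `τ = s + d (1/2 - 1/p)` their `ℓ^p` norm is the norm
of `B^s_p`. -/
def scaledCoeff (W : WaveletSystem d) (τ : ℝ) (u : Distr d) (l : Index d) : ℝ :=
  levelWeight τ l * u (W.fn l)

lemma scaledCoeff_sub (τ : ℝ) (u v : Distr d) (l : Index d) :
    scaledCoeff W τ (u - v) l = scaledCoeff W τ u l - scaledCoeff W τ v l :=
  mul_sub _ _ _

lemma abs_scaledCoeff (τ : ℝ) (u : Distr d) (l : Index d) :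
    |scaledCoeff W τ u l| = levelWeight τ l * |u (W.fn l)| := by
  rw [scaledCoeff, abs_mul, abs_of_pos (levelWeight_pos τ l)]

lemma abs_scaledCoeff_mono {σ τ : ℝ} (h : σ ≤ τ) (u : Distr d) (l : Index d) :
    |scaledCoeff W σ u l| ≤ |scaledCoeff W τ u l| := by
  simp only [abs_scaledCoeff]
  gcongr
  exact levelWeight_mono h l

lemma rateSmoothness_two (d : ℕ) (s : ℝ) : rateSmoothness d s 2 = s := by
  simp [rateSmoothness]

lemma rateSmoothness_one (d : ℕ) (s : ℝ) : rateSmoothness d s 1 = s - d / 2 := by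
  rw [rateSmoothness]
  ring

lemma besovPow_eq_tsum_scaledCoeff (s p : ℝ) (u : Distr d) :
    besovPow W s p u =
      ∑' l, ENNReal.ofReal (|scaledCoeff W (rateSmoothness d s p) u l| ^ p) := by
  refine tsum_congr fun l => congrArg ENNReal.ofReal ?_
  rw [abs_scaledCoeff, Real.mul_rpow (levelWeight_pos _ l).le (abs_nonneg _), levelWeight_rpow]
  rfl

lemma besovPow_lt_top_iff {s p : ℝ} {u : Distr d} :
    besovPow W s p u < ∞ ↔
      Summable fun l => |scaledCoeff W (rateSmoothness d s p) u l| ^ p := by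
  rw [besovPow_eq_tsum_scaledCoeff]
  refine ⟨fun h => (ENNReal.summable_toReal h.ne).congr fun l => ?_,
    fun h => h.tsum_ofReal_lt_top⟩
  exact ENNReal.toReal_ofReal (by positivity)

lemma toReal_besovPow (s p : ℝ) (u : Distr d) :
    (besovPow W s p u).toReal = ∑' l, |scaledCoeff W (rateSmoothness d s p) u l| ^ p := by
  rw [besovPow_eq_tsum_scaledCoeff, ENNReal.tsum_toReal_eq fun _ => ENNReal.ofReal_ne_top]
  exact tsum_congr fun l => ENNReal.toReal_ofReal (by positivity)

lemma mem_besov_iff_summable {s p : ℝ} {hp : 0 < p} {u : Distr d} :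
    u ∈ besov W s p hp ↔ HasWaveletExpansion W u ∧
      Summable fun l => |scaledCoeff W (rateSmoothness d s p) u l| ^ p :=
  and_congr_right' besovPow_lt_top_iff

lemma besovNorm_lt_top_iff {s p : ℝ} (hp : 0 < p) {u : Distr d} :
    besovNorm W s p u < ∞ ↔ besovPow W s p u < ∞ :=
  ENNReal.rpow_lt_top_iff_of_pos (one_div_pos.2 hp)

lemma abs_scaledCoeff_le_of_besovPow_le {s p M : ℝ} (hp : 0 < p) (hM : 0 ≤ M) {u : Distr d}
    (h : besovPow W s p u ≤ ENNReal.ofReal M) (l : Index d) :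
    |scaledCoeff W (rateSmoothness d s p) u l| ≤ M ^ p⁻¹ := by
  rw [besovPow_eq_tsum_scaledCoeff] at h
  rw [Real.le_rpow_inv_iff_of_pos (abs_nonneg _) hM hp]
  exact (ENNReal.ofReal_le_ofReal_iff hM).1 ((ENNReal.le_tsum l).trans h)

lemma besovNorm_two_le_ofReal_sqrt {s x : ℝ} {u : Distr d}
    (h : besovPow W s 2 u ≤ ENNReal.ofReal x) : besovNorm W s 2 u ≤ ENNReal.ofReal √x := by
  refine (ENNReal.rpow_le_rpow h (by positivity)).trans_eq ?_
  rcases le_total 0 x with hx | hx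
  · rw [ENNReal.ofReal_rpow_of_nonneg hx (by positivity), ← Real.sqrt_eq_rpow]
  · rw [ENNReal.ofReal_of_nonpos hx, Real.sqrt_eq_zero_of_nonpos hx, ENNReal.ofReal_zero,
      ENNReal.zero_rpow_of_pos (by positivity)]

/-! ### Square integrable functions -/

/-- The wavelets as a Hilbert basis of `L_2`. -/
def WaveletSystem.basis (W : WaveletSystem d) : HilbertBasis (Index d) ℝ (L2 d) :=
  HilbertBasis.mk W.orthonormal W.complete

lemma WaveletSystem.basis_apply (W : WaveletSystem d) (l : Index d) :
    W.basis l = ((W.fn l).toLp 2 : L2 d) := by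
  rw [WaveletSystem.basis, HilbertBasis.coe_mk]
  rfl

lemma ofL2_apply (f : L2 d) (χ : 𝓢(Pt d, ℝ)) : ofL2 f χ = inner ℝ f (χ.toLp 2 : L2 d) := rfl

lemma ofL2_apply_fn (f : L2 d) (l : Index d) : ofL2 f (W.fn l) = W.basis.repr f l := by
  rw [HilbertBasis.repr_apply_apply, W.basis_apply, real_inner_comm, ofL2_apply]

lemma inner_fn_fn (W : WaveletSystem d) (l m : Index d) :
    inner ℝ ((W.fn l).toLp 2 : L2 d) ((W.fn m).toLp 2) = if l = m then (1 : ℝ) else 0 :=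
  orthonormal_iff_ite.1 W.orthonormal l m

lemma hasWaveletExpansion_ofL2 (f : L2 d) : HasWaveletExpansion W (ofL2 f) :=
  (ofL2_mem_sobolev W le_rfl f).1

lemma HasWaveletExpansion.ext {u v : Distr d} (hu : HasWaveletExpansion W u)
    (hv : HasWaveletExpansion W v) (h : ∀ l, u (W.fn l) = v (W.fn l)) : u = v := by
  ext χ
  refine (hu χ).unique ?_
  simpa only [h] using hv χ

lemma exists_ofL2_apply_fn_eq {c : Index d → ℝ} (hc : Memℓp c 2) :
    ∃ f : L2 d, ∀ l, ofL2 f (W.fn l) = c l :=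
  ⟨W.basis.repr.symm ⟨c, hc⟩, fun l => by
    rw [ofL2_apply_fn, LinearIsometryEquiv.apply_symm_apply]⟩

lemma ofL2_injective (W : WaveletSystem d) : Function.Injective (ofL2 : L2 d → Distr d) := by
  intro f g h
  apply W.basis.repr.injective
  ext l
  rw [← ofL2_apply_fn, ← ofL2_apply_fn, h]

lemma l2Norm_ofL2 (W : WaveletSystem d) (f : L2 d) : l2Norm (ofL2 f) = ‖f‖ₑ := by
  refine le_antisymm (iInf₂_le_of_le f rfl le_rfl) (le_iInf₂ fun g hg => ?_)
  rw [ofL2_injective W hg]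

lemma l2Norm_lt_top_iff {u : Distr d} : l2Norm u < ∞ ↔ ∃ f : L2 d, u = ofL2 f := by
  simp [l2Norm, iInf_lt_iff]

lemma besovNorm_ofL2 (W : WaveletSystem d) (f : L2 d) : besovNorm W 0 2 (ofL2 f) = ‖f‖ₑ := by
  have parseval : HasSum (fun l => |scaledCoeff W 0 (ofL2 f) l| ^ (2 : ℝ)) (‖f‖ ^ 2) := by
    rw [← real_inner_self_eq_norm_sq]
    refine (W.basis.hasSum_inner_mul_inner f f).congr_fun fun l => ?_
    simp [scaledCoeff, levelWeight, ofL2_apply, W.basis_apply, real_inner_comm f, sq]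
  rw [besovNorm, besovPow_eq_tsum_scaledCoeff, rateSmoothness_two,
    ← ENNReal.ofReal_tsum_of_nonneg (fun _ => by positivity) parseval.summable, parseval.tsum_eq,
    ENNReal.ofReal_rpow_of_nonneg (by positivity) (by positivity), ← Real.sqrt_eq_rpow,
    Real.sqrt_sq (norm_nonneg _), ofReal_norm]

lemma mem_sobolev_zero_iff {u : Distr d} : u ∈ sobolev W 0 ↔ ∃ f : L2 d, u = ofL2 f := by
  refine ⟨fun hu => ?_, fun ⟨f, hf⟩ => hf ▸ ofL2_mem_sobolev W le_rfl f⟩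
  obtain ⟨hexp, hsum⟩ := mem_besov_iff_summable.1 hu
  obtain ⟨f, hf⟩ := exists_ofL2_apply_fn_eq (W := W) (c := fun l => u (W.fn l)) <| by
    rw [memℓp_gen_iff (by norm_num)]
    simpa [scaledCoeff, levelWeight, rateSmoothness] using hsum
  exact ⟨f, hexp.ext (hasWaveletExpansion_ofL2 f) fun l => (hf l).symm⟩

lemma mem_sobolev_zero_iff_l2Norm_lt_top {u : Distr d} : u ∈ sobolev W 0 ↔ l2Norm u < ∞ := by
  rw [mem_sobolev_zero_iff, l2Norm_lt_top_iff]

lemma HasWaveletExpansion.besovNorm_zero_two {u : Distr d} (hu : HasWaveletExpansion W u) :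
    besovNorm W 0 2 u = l2Norm u := by
  by_cases h : ∃ f : L2 d, u = ofL2 f
  · obtain ⟨f, rfl⟩ := h
    rw [besovNorm_ofL2, l2Norm_ofL2 W]
  · have hl2 : ¬ l2Norm u < ∞ := mt l2Norm_lt_top_iff.1 h
    have hbesov : ¬ besovNorm W 0 2 u < ∞ := fun hlt =>
      h (mem_sobolev_zero_iff.1 ⟨hu, (besovNorm_lt_top_iff two_pos).1 hlt⟩)
    rw [not_lt_top_iff.1 hl2, not_lt_top_iff.1 hbesov]

/-! ### Embeddings -/

lemma tsum_rpow_le_rpow_tsum {ι : Type*} {r : ℝ} (hr : 1 ≤ r) (f : ι → ℝ≥0∞) :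
    ∑' i, f i ^ r ≤ (∑' i, f i) ^ r := by
  have split : ∀ a : ℝ≥0∞, a ^ r = a * a ^ (r - 1) := fun a => by
    conv_lhs => rw [← add_sub_cancel 1 r, ENNReal.rpow_add_of_nonneg _ _ zero_le_one
      (sub_nonneg.2 hr), ENNReal.rpow_one]
  rw [split (∑' i, f i), ← ENNReal.tsum_mul_right]
  refine ENNReal.tsum_le_tsum fun i => ?_
  rw [split]
  gcongr
  exact ENNReal.le_tsum i

lemma besovNorm_le_besovNorm {s t p q : ℝ} (hp : 0 < p) (hpq : p ≤ q)
    (h : rateSmoothness d t q ≤ rateSmoothness d s p) (u : Distr d) :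
    besovNorm W t q u ≤ besovNorm W s p u := by
  have hq : 0 < q := hp.trans_le hpq
  have hpow : besovPow W t q u ≤ besovPow W s p u ^ (q / p) := by
    rw [besovPow_eq_tsum_scaledCoeff, besovPow_eq_tsum_scaledCoeff]
    refine le_trans (ENNReal.tsum_le_tsum fun l => ?_)
      (tsum_rpow_le_rpow_tsum ((one_le_div hp).2 hpq) _)
    rw [ENNReal.ofReal_rpow_of_nonneg (by positivity) (by positivity),
      ← Real.rpow_mul (abs_nonneg _), mul_div_cancel₀ _ hp.ne']
    exact ENNReal.ofReal_le_ofReal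
      (Real.rpow_le_rpow (abs_nonneg _) (abs_scaledCoeff_mono h u l) hq.le)
  calc besovNorm W t q u ≤ (besovPow W s p u ^ (q / p)) ^ (1 / q) :=
        ENNReal.rpow_le_rpow hpow (by positivity)
    _ = besovNorm W s p u := by
        rw [← ENNReal.rpow_mul, besovNorm]
        congr 1
        field_simp

lemma contEmbeds_of_rateSmoothness_le {s t p q : ℝ} (hp : 0 < p) (hq : 0 < q) (hpq : p ≤ q)
    (h : rateSmoothness d t q ≤ rateSmoothness d s p) : ContEmbeds W s p hp t q hq := by
  refine ⟨fun u hu => ⟨hu.1, (besovNorm_lt_top_iff hq).1 ?_⟩, 1, fun u _ => ?_⟩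
  · exact (besovNorm_le_besovNorm hp hpq h u).trans_lt ((besovNorm_lt_top_iff hp).2 hu.2)
  · rw [ENNReal.coe_one, one_mul]
    exact besovNorm_le_besovNorm hp hpq h u

lemma exists_mem_besov_apply_fn_eq {s p : ℝ} (hp : 0 < p) (hp2 : p ≤ 2)
    (hs : 0 ≤ rateSmoothness d s p) {c : Index d → ℝ}
    (hc : Summable fun l => |levelWeight (rateSmoothness d s p) l * c l| ^ p) :
    ∃ u ∈ besov W s p hp, ∀ l, u (W.fn l) = c l := by
  have hcp : Memℓp c (ENNReal.ofReal p) := by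
    rw [memℓp_gen_iff (by rwa [ENNReal.toReal_ofReal hp.le]), ENNReal.toReal_ofReal hp.le]
    refine hc.of_nonneg_of_le (fun l => by positivity) fun l => ?_
    rw [Real.norm_eq_abs, abs_mul, abs_of_pos (levelWeight_pos _ l)]
    gcongr
    exact le_mul_of_one_le_left (abs_nonneg _) (one_le_levelWeight hs l)
  obtain ⟨f, hf⟩ := exists_ofL2_apply_fn_eq (W := W)
    (hcp.of_exponent_ge (by simpa using ENNReal.ofReal_le_ofReal hp2))
  refine ⟨ofL2 f, mem_besov_iff_summable.2 ⟨hasWaveletExpansion_ofL2 f, ?_⟩, hf⟩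
  simpa only [scaledCoeff, hf] using hc

/-! ### Strictness of the embeddings -/

/-- The index of a mother wavelet at level `j` and position `0`, for lacunary wavelet series. -/
def centralIndex (hd : 0 < d) (j : ℕ) : Index d :=
  Sum.inr (j, ⟨0, Nat.sub_pos_of_lt (Nat.one_lt_two_pow hd.ne')⟩, 0)

lemma centralIndex_injective (hd : 0 < d) : Function.Injective (centralIndex hd) := by
  intro i j h
  simpa [centralIndex] using h

lemma level_centralIndex (hd : 0 < d) (j : ℕ) : (centralIndex hd j).level = j := rfl

lemma summable_two_rpow_mul_iff {a : ℝ} :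
    (Summable fun j : ℕ => (2 : ℝ) ^ (a * (j : ℝ))) ↔ a < 0 := by
  simp_rw [Real.rpow_mul zero_le_two, Real.rpow_natCast]
  rw [summable_geometric_iff_norm_lt_one, Real.norm_of_nonneg (by positivity)]
  exact ⟨fun h => not_le.1 fun ha => h.not_ge (Real.one_le_rpow one_le_two ha),
    Real.rpow_lt_one_of_one_lt_of_neg one_lt_two⟩

lemma abs_inner_toLp_le (f g : 𝓢(Pt d, ℝ)) :
    |inner ℝ (f.toLp 2 : L2 d) (g.toLp 2)| ≤ (∫ x, ‖f x‖) * SchwartzMap.seminorm ℝ 0 0 g := by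
  have inner_eq : inner ℝ (f.toLp 2 : L2 d) (g.toLp 2) = ∫ x, g x * f x := by
    rw [L2.inner_def]
    refine integral_congr_ae ?_
    filter_upwards [f.coeFn_toLp 2, g.coeFn_toLp 2] with x hf hg
    rw [hf, hg]
    rfl
  rw [inner_eq, ← integral_mul_const, ← Real.norm_eq_abs]
  refine norm_integral_le_of_norm_le (f.integrable.norm.mul_const _)
    (Filter.Eventually.of_forall fun x => ?_)
  rw [norm_mul, mul_comm]
  gcongr
  exact g.norm_le_seminorm ℝ x

lemma integral_norm_dilate_zero (f : 𝓢(Pt d, ℝ)) (j : ℕ) :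
    ∫ x, ‖dilate f j 0 x‖ = (2 : ℝ) ^ (-(d : ℝ) / 2 * j) * ∫ x, ‖f x‖ := by
  have intPt_zero : intPt (0 : Fin d → ℤ) = 0 := by ext i; simp [intPt]
  simp_rw [dilate_apply, intPt_zero, sub_zero, norm_mul]
  rw [integral_const_mul, Measure.integral_comp_smul_of_nonneg volume (fun x => ‖f x‖) _
    (hR := by positivity), finrank_euclideanSpace_fin, smul_eq_mul, ← mul_assoc,
    Real.norm_of_nonneg (by positivity)]
  congr 1
  rw [← Real.rpow_natCast, ← Real.rpow_natCast, ← Real.rpow_mul zero_le_two,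
    ← Real.rpow_neg zero_le_two, ← Real.rpow_add two_pos]
  ring_nf

lemma exists_abs_inner_centralIndex_le (W : WaveletSystem d) (hd : 0 < d) :
    ∃ C : ℝ, ∀ (j : ℕ) (χ : 𝓢(Pt d, ℝ)),
      |inner ℝ ((W.fn (centralIndex hd j)).toLp 2 : L2 d) (χ.toLp 2)| ≤
        C * (2 : ℝ) ^ (-(d : ℝ) / 2 * j) * SchwartzMap.seminorm ℝ 0 0 χ :=
  ⟨_, fun j χ => (abs_inner_toLp_le _ χ).trans_eq
    (congrArg (· * _) ((integral_norm_dilate_zero _ j).trans (mul_comm _ _)))⟩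

lemma exists_distr_hasSum {ι : Type*} {f : ι → Distr d} {b : ι → ℝ} (hb : Summable b)
    (hfb : ∀ i (χ : 𝓢(Pt d, ℝ)), |f i χ| ≤ b i * SchwartzMap.seminorm ℝ 0 0 χ) :
    ∃ u : Distr d, ∀ χ, HasSum (fun i => f i χ) (u χ) := by
  have hsum : ∀ χ : 𝓢(Pt d, ℝ), Summable fun i => f i χ := fun χ =>
    (hb.mul_right _).of_norm_bounded fun i => hfb i χ
  have hbound : ∀ χ : 𝓢(Pt d, ℝ), ‖∑' i, f i χ‖ ≤
      |∑' i, b i| * (({0} : Finset (ℕ × ℕ)).sup (schwartzSeminormFamily ℝ (Pt d) ℝ)) χ := by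
    intro χ
    rw [Finset.sup_singleton]
    exact (tsum_of_norm_bounded (hb.hasSum.mul_right _) fun i => hfb i χ).trans
      (mul_le_mul_of_nonneg_right (le_abs_self _) (apply_nonneg _ χ))
  exact ⟨SchwartzMap.mkCLMtoNormedSpace (σ := RingHom.id ℝ) (fun χ => ∑' i, f i χ)
    (fun χ χ' => by simp_rw [map_add]; exact (hsum χ).tsum_add (hsum χ'))
    (fun a χ => by simp_rw [map_smul, smul_eq_mul, tsum_mul_left]; rfl)
    ⟨{0}, _, abs_nonneg _, hbound⟩, fun χ => (hsum χ).hasSum⟩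

lemma exists_lacunary (W : WaveletSystem d) (hd : 0 < d) {c : ℕ → ℝ}
    (hc : Summable fun j : ℕ => |c j| * (2 : ℝ) ^ (-(d : ℝ) / 2 * j)) :
    ∃ u : Distr d, HasWaveletExpansion W u ∧ (∀ j, u (W.fn (centralIndex hd j)) = c j) ∧
      ∀ l ∉ Set.range (centralIndex hd), u (W.fn l) = 0 := by
  obtain ⟨C, hC⟩ := exists_abs_inner_centralIndex_le W hd
  obtain ⟨u, hu⟩ := exists_distr_hasSum
    (f := fun j => c j • ofL2 ((W.fn (centralIndex hd j)).toLp 2)) (hc.mul_left C) fun j χ => by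
      rw [smul_apply, smul_eq_mul, abs_mul]
      exact (mul_le_mul_of_nonneg_left (hC j χ) (abs_nonneg _)).trans_eq (by ring)
  simp only [smul_apply, smul_eq_mul, ofL2_apply] at hu
  have hu_central : ∀ j, u (W.fn (centralIndex hd j)) = c j := fun j => by
    refine (hu _).unique ?_
    convert! hasSum_ite_eq j (c j) using 2 with i
    simp only [inner_fn_fn, (centralIndex_injective hd).eq_iff, mul_ite, mul_one, mul_zero]
    grind
  have hu_other : ∀ l ∉ Set.range (centralIndex hd), u (W.fn l) = 0 := fun l hl => by
    refine (hu _).unique ?_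
    convert! hasSum_zero using 2 with j
    rw [inner_fn_fn, if_neg fun h => hl ⟨j, h⟩, mul_zero]
  refine ⟨u, fun χ => ?_, hu_central, hu_other⟩
  rw [← (centralIndex_injective hd).hasSum_iff fun l hl => by rw [hu_other l hl, zero_mul]]
  simp only [Function.comp_def, hu_central]
  exact hu χ

lemma exists_distr_forall_mem_besov_iff (W : WaveletSystem d) (hd : 0 < d) {τ : ℝ}
    (hτ : -(d : ℝ) / 2 < τ) :
    ∃ u : Distr d, ∀ s p (hp : 0 < p), u ∈ besov W s p hp ↔ rateSmoothness d s p < τ := by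
  obtain ⟨u, hexp, hu_central, hu_other⟩ := exists_lacunary W hd (c := fun j => 2 ^ (-τ * j)) <| by
    simp_rw [abs_of_pos (Real.rpow_pos_of_pos two_pos _), ← Real.rpow_add two_pos, ← add_mul]
    exact summable_two_rpow_mul_iff.2 (by linarith)
  refine ⟨u, fun s p hp => ?_⟩
  have hterm : ∀ j, |scaledCoeff W (rateSmoothness d s p) u (centralIndex hd j)| ^ p =
      2 ^ (p * (rateSmoothness d s p - τ) * j) := fun j => by
    rw [scaledCoeff, hu_central, levelWeight, level_centralIndex, ← Real.rpow_add two_pos,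
      abs_of_pos (by positivity), ← Real.rpow_mul zero_le_two]
    ring_nf
  rw [mem_besov_iff_summable, and_iff_right hexp, ← (centralIndex_injective hd).summable_iff
    fun l hl => by rw [scaledCoeff, hu_other l hl, mul_zero, abs_zero, Real.zero_rpow hp.ne']]
  simp only [Function.comp_def, hterm]
  rw [summable_two_rpow_mul_iff, ← neg_pos, ← mul_neg, mul_pos_iff_of_pos_left hp, neg_sub,
    sub_pos]

lemma besov_lt_besov (W : WaveletSystem d) (hd : 0 < d) {s t p q : ℝ} (hp : 0 < p) (hq : 0 < q)
    (hpq : p ≤ q) (hlt : rateSmoothness d t q < rateSmoothness d s p)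
    (hs : -(d : ℝ) / 2 < rateSmoothness d s p) : besov W s p hp < besov W t q hq := by
  obtain ⟨u, hu⟩ := exists_distr_forall_mem_besov_iff W hd hs
  exact lt_of_le_not_ge (contEmbeds_of_rateSmoothness_le hp hq hpq hlt.le).1 fun hle =>
    lt_irrefl _ ((hu s p hp).1 (hle ((hu t q hq).2 hlt)))

/-! ### Operators on Besov spaces -/

lemma ofL2_fn_apply_fn (l m : Index d) :
    ofL2 ((W.fn l).toLp 2) (W.fn m) = if l = m then 1 else 0 :=
  inner_fn_fn W l m

/-- The wavelet `ψ_λ` as an element of `B^s_p`. -/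
def WaveletSystem.toBesov (W : WaveletSystem d) (s p : ℝ) (hp : 0 < p) (l : Index d) :
    besov W s p hp :=
  ⟨ofL2 ((W.fn l).toLp 2), mem_besov_iff_summable.2 ⟨hasWaveletExpansion_ofL2 _,
    summable_of_ne_finset_zero (s := {l}) fun m hm => by
      rw [scaledCoeff, ofL2_fn_apply_fn, if_neg fun h => hm (Finset.mem_singleton.2 h.symm),
        mul_zero, abs_zero, Real.zero_rpow hp.ne']⟩⟩

lemma toBesov_apply_fn {s p : ℝ} (hp : 0 < p) (l m : Index d) :
    (W.toBesov s p hp l : Distr d) (W.fn m) = if l = m then 1 else 0 :=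
  ofL2_fn_apply_fn l m

lemma sub_partialSum_apply_fn {s p : ℝ} {hp : 0 < p} (h : besov W s p hp)
    (t : Finset (Index d)) (m : Index d) :
    ((h - ∑ l ∈ t, (h : Distr d) (W.fn l) • W.toBesov s p hp l : besov W s p hp) : Distr d)
      (W.fn m) = if m ∈ t then 0 else (h : Distr d) (W.fn m) := by
  simp only [Submodule.coe_sub, Submodule.coe_sum, Submodule.coe_smul, sub_apply, sum_apply,
    smul_apply, toBesov_apply_fn, smul_eq_mul, mul_ite, mul_one, mul_zero, Finset.sum_ite_eq']
  split_ifs <;> simp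

lemma tendsto_besovPow_sub_partialSum {s p : ℝ} {hp : 0 < p} (h : besov W s p hp) :
    Filter.Tendsto (fun t : Finset (Index d) => besovPow W s p
      (h - ∑ l ∈ t, (h : Distr d) (W.fn l) • W.toBesov s p hp l : besov W s p hp))
      Filter.atTop (nhds 0) := by
  have tail_tendsto := ENNReal.tendsto_tsum_compl_atTop_zero
    ((besovPow_eq_tsum_scaledCoeff s p (h : Distr d)).symm.trans_ne h.2.2.ne)
  refine tail_tendsto.congr fun t => ?_
  rw [besovPow_eq_tsum_scaledCoeff]
  refine (tsum_subtype {l | l ∉ t} fun l =>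
    ENNReal.ofReal (|scaledCoeff W (rateSmoothness d s p) h l| ^ p)).trans
      (tsum_congr fun l => ?_)
  simp only [scaledCoeff, sub_partialSum_apply_fn]
  by_cases hl : l ∈ t
  · simp [hl, hp.ne', Real.zero_rpow]
  · rw [Set.indicator_of_mem (by exact hl), if_neg hl]

lemma hasSum_map_wavelets {E : Type*} [SeminormedAddCommGroup E] [NormedSpace ℝ E] {s p : ℝ}
    {hp : 0 < p} {F : besov W s p hp →ₗ[ℝ] E}
    (hF : ∃ C : ℝ≥0, ∀ u, ‖F u‖ₑ ≤ C * besovNorm W s p u) (h : besov W s p hp) :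
    HasSum (fun l => (h : Distr d) (W.fn l) • F (W.toBesov s p hp l)) (F h) := by
  obtain ⟨C, hC⟩ := hF
  rw [HasSum, SummationFilter.unconditional_filter, tendsto_iff_edist_tendsto_0]
  have norm_tendsto := ((ENNReal.continuous_rpow_const (y := 1 / p)).tendsto 0).comp
    (tendsto_besovPow_sub_partialSum h)
  have bound_tendsto := ENNReal.Tendsto.const_mul (a := (C : ℝ≥0∞)) norm_tendsto
    (Or.inr ENNReal.coe_ne_top)
  rw [ENNReal.zero_rpow_of_pos (one_div_pos.2 hp), mul_zero] at bound_tendsto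
  refine tendsto_of_tendsto_of_tendsto_of_le_of_le tendsto_const_nhds bound_tendsto
    (fun _ => zero_le) fun t => ?_
  rw [edist_comm, edist_eq_enorm_sub]
  simp_rw [← map_smul]
  rw [← map_sum, ← map_sub]
  exact hC _

lemma exists_hasSum_of_mem_adjointRange {s p : ℝ} {hp : 0 < p} {F : besov W s p hp →ₗ[ℝ] L2 d}
    (hF : ∃ C : ℝ≥0, ∀ u, ‖F u‖ₑ ≤ C * besovNorm W s p u) {ξ : Distr d}
    (hξ : ξ ∈ adjointRange F) :
    ∃ w : L2 d, ∀ h : besov W s p hp,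
      HasSum (fun l => ξ (W.fn l) * (h : Distr d) (W.fn l)) (inner ℝ w (F h)) := by
  obtain ⟨w, hw⟩ := hξ
  refine ⟨w, fun h => ?_⟩
  have hsum := (hasSum_map_wavelets hF h).mapL (innerSL ℝ w)
  simp only [innerSL_apply_apply, inner_smul_right] at hsum
  convert! hsum using 2 with l
  rw [hw (W.fn l) (W.toBesov s p hp l) rfl, mul_comm]

/-! ### Minimizers of the Tikhonov functional -/

lemma penalty_le_of_residual_le {E : Type*} [SeminormedAddCommGroup E] {f f₀ v : E}
    {α δ c R R₀ : ℝ} (hc : 0 < c) (hδ : 0 < δ) (hδ1 : δ ≤ 1) (hα : c * δ ≤ α) (hv : ‖v - f₀‖ ≤ δ)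
    (hmin : ‖f - v‖ ^ 2 + α * R ≤ ‖f₀ - v‖ ^ 2 + α * R₀) :
    R ≤ 1 / c + R₀ := by
  have hα_pos : 0 < α := (mul_pos hc hδ).trans_le hα
  have hδα : δ ≤ α * (1 / c) := by rwa [mul_one_div, le_div_iff₀ hc, mul_comm]
  have hnoise : ‖f₀ - v‖ ^ 2 ≤ δ := by
    rw [norm_sub_rev]
    nlinarith [norm_nonneg (v - f₀)]
  refine le_of_mul_le_mul_left ?_ hα_pos
  linarith [sq_nonneg ‖f - v‖]

section Residual

variable {H : Type*} [NormedAddCommGroup H] [InnerProductSpace ℝ H] {f f₀ v : H}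
  {α δ c C R R₀ : ℝ}

lemma mul_bregman_le_of_residual_le (hα : 0 ≤ α) (hv : ‖v - f₀‖ ≤ δ)
    (hmin : ‖f - v‖ ^ 2 + α * R ≤ ‖f₀ - v‖ ^ 2 + α * R₀) (w : H) :
    α * (R - R₀ - inner ℝ w (f - f₀)) ≤ (δ + α / 2 * ‖w‖) ^ 2 := by
  have complete_square : ‖f₀ - v‖ ^ 2 - ‖f - v‖ ^ 2 - α * inner ℝ w (f - f₀) =
      ‖v - f₀ - (α / 2) • w‖ ^ 2 - ‖f - v + (α / 2) • w‖ ^ 2 := by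
    rw [norm_sub_sq_real (v - f₀), norm_add_sq_real, norm_sub_rev f₀, inner_smul_right,
      inner_smul_right, ← sub_add_sub_cancel f v f₀, inner_add_right, real_inner_comm w,
      real_inner_comm w]
    ring
  calc α * (R - R₀ - inner ℝ w (f - f₀))
      ≤ ‖v - f₀ - (α / 2) • w‖ ^ 2 := by linarith [sq_nonneg ‖f - v + (α / 2) • w‖]
    _ ≤ (δ + α / 2 * ‖w‖) ^ 2 := by
        gcongr
        refine (norm_sub_le _ _).trans (add_le_add hv ?_)
        rw [norm_smul, Real.norm_of_nonneg (by positivity)]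

lemma bregman_le_of_residual_le (hc : 0 < c) (hδ : 0 < δ) (hα : c * δ ≤ α) (hαC : α ≤ C * δ)
    (hv : ‖v - f₀‖ ≤ δ) (hmin : ‖f - v‖ ^ 2 + α * R ≤ ‖f₀ - v‖ ^ 2 + α * R₀) (w : H) :
    R - R₀ - inner ℝ w (f - f₀) ≤ (1 + C / 2 * ‖w‖) ^ 2 / c * δ := by
  have hα_pos : 0 < α := (mul_pos hc hδ).trans_le hα
  refine le_of_mul_le_mul_left ?_ hα_pos
  calc α * (R - R₀ - inner ℝ w (f - f₀)) ≤ (δ + α / 2 * ‖w‖) ^ 2 :=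
        mul_bregman_le_of_residual_le hα_pos.le hv hmin w
    _ ≤ (δ + C * δ / 2 * ‖w‖) ^ 2 := by gcongr
    _ = c * δ * ((1 + C / 2 * ‖w‖) ^ 2 / c * δ) := by field_simp
    _ ≤ α * ((1 + C / 2 * ‖w‖) ^ 2 / c * δ) := by gcongr

end Residual

section Minimizer

variable {D : Submodule ℝ (Distr d)} {F : D →ₗ[ℝ] L2 d} {s p α : ℝ} {v : L2 d} {u u₀ : D}

lemma tikhonov_eq_ofReal (hα : 0 ≤ α) (hu : besovPow W s p u < ∞) :
    tikhonov W F s p α v u =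
      ENNReal.ofReal (‖F u - v‖ ^ 2 + α * (besovPow W s p u).toReal) := by
  rw [ENNReal.ofReal_add (by positivity) (by positivity), ENNReal.ofReal_mul hα,
    ENNReal.ofReal_toReal hu.ne, tikhonov]

lemma besovPow_lt_top_of_tikhonov_le (hα : 0 < α) (hu₀ : besovPow W s p u₀ < ∞)
    (h : tikhonov W F s p α v u ≤ tikhonov W F s p α v u₀) : besovPow W s p u < ∞ := by
  rw [tikhonov_eq_ofReal hα.le hu₀] at h
  exact ENNReal.lt_top_of_mul_ne_top_right
    (le_add_self.trans_lt (h.trans_lt ENNReal.ofReal_lt_top)).ne (by simpa using hα)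

lemma residual_le_of_tikhonov_le (hα : 0 < α) (hu₀ : besovPow W s p u₀ < ∞)
    (h : tikhonov W F s p α v u ≤ tikhonov W F s p α v u₀) :
    ‖F u - v‖ ^ 2 + α * (besovPow W s p u).toReal ≤
      ‖F u₀ - v‖ ^ 2 + α * (besovPow W s p u₀).toReal := by
  have hu := besovPow_lt_top_of_tikhonov_le hα hu₀ h
  rw [tikhonov_eq_ofReal hα.le hu, tikhonov_eq_ofReal hα.le hu₀] at h
  exact (ENNReal.ofReal_le_ofReal_iff (by positivity)).1 h

lemma ConvergesAtRateSqrt.mono {N N' : Distr d → ℝ≥0∞} (h : ConvergesAtRateSqrt W F s p N u₀)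
    (hN : ∀ u : D, N' ((u : Distr d) - u₀) ≤ N ((u : Distr d) - u₀)) :
    ConvergesAtRateSqrt W F s p N' u₀ := by
  intro c C hc
  obtain ⟨K, δ₀, hδ₀, hK⟩ := h c C hc
  exact ⟨K, δ₀, hδ₀, fun δ hδ hδ' α hα hα' v hv u hu =>
    (hN u).trans (hK δ hδ hδ' α hα hα' v hv u hu)⟩

theorem convergesAtRateSqrt_of_le_bregman {N : Distr d → ℝ≥0∞} {w : L2 d}
    (hu₀ : besovPow W s p u₀ < ∞)
    (hN : ∀ M : ℝ, ∃ κ : ℝ, 0 ≤ κ ∧ ∀ u : D, besovPow W s p u ≤ ENNReal.ofReal M →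
      N ((u : Distr d) - u₀) ≤ ENNReal.ofReal √(κ *
        ((besovPow W s p u).toReal - (besovPow W s p u₀).toReal - inner ℝ w (F u - F u₀)))) :
    ConvergesAtRateSqrt W F s p N u₀ := by
  intro c C hc
  obtain ⟨κ, hκ, hκN⟩ := hN (1 / c + (besovPow W s p u₀).toReal)
  refine ⟨√(κ * ((1 + C / 2 * ‖w‖) ^ 2 / c)), 1, one_pos, fun δ hδ hδ1 α hα hαC v hv u hu => ?_⟩
  have hα_pos : 0 < α := (mul_pos hc hδ).trans_le hα
  have hu_finite := besovPow_lt_top_of_tikhonov_le hα_pos hu₀ (hu u₀)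
  have hmin := residual_le_of_tikhonov_le hα_pos hu₀ (hu u₀)
  have hpenalty : besovPow W s p u ≤ ENNReal.ofReal (1 / c + (besovPow W s p u₀).toReal) := by
    rw [ENNReal.le_ofReal_iff_toReal_le hu_finite.ne (by positivity)]
    exact penalty_le_of_residual_le hc hδ hδ1 hα hv hmin
  refine (hκN u hpenalty).trans (ENNReal.ofReal_le_ofReal ?_)
  rw [← Real.sqrt_mul (by positivity), mul_assoc]
  gcongr
  exact bregman_le_of_residual_le hc hδ hα hαC hv hmin w

end Minimizer

/-! ### Uniform convexity -/

/-- The duality map `x ↦ |x|^{p-2} x` of `ℝ`, which is the derivative of `|x|^p / p`. -/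
def dualityMap (p x : ℝ) : ℝ := |x| ^ (p - 2) * x

lemma dualityMap_neg (p x : ℝ) : dualityMap p (-x) = -dualityMap p x := by
  rw [dualityMap, dualityMap, abs_neg, mul_neg]

lemma dualityMap_of_nonneg {p x : ℝ} (hp : p ≠ 1) (hx : 0 ≤ x) : dualityMap p x = x ^ (p - 1) := by
  rcases hx.eq_or_lt with rfl | hx
  · rw [dualityMap, mul_zero, Real.zero_rpow (sub_ne_zero.2 hp)]
  · rw [dualityMap, abs_of_pos hx, ← Real.rpow_add_one hx.ne']
    ring_nf

lemma abs_dualityMap {p : ℝ} (hp : p ≠ 1) (x : ℝ) : |dualityMap p x| = |x| ^ (p - 1) := by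
  rw [← dualityMap_of_nonneg hp (abs_nonneg x), dualityMap, dualityMap, abs_abs, abs_mul,
    abs_of_nonneg (Real.rpow_nonneg (abs_nonneg x) _)]

lemma dualityMap_mul_self {p : ℝ} (hp : p ≠ 0) (x : ℝ) : dualityMap p x * x = |x| ^ p := by
  rcases eq_or_ne x 0 with rfl | hx
  · rw [mul_zero, abs_zero, Real.zero_rpow hp]
  · rw [dualityMap, mul_assoc, ← abs_mul_abs_self, ← sq, ← Real.rpow_natCast,
      ← Real.rpow_add (abs_pos.2 hx)]
    norm_num

lemma mul_sub_le_rpow_sub_rpow {r x y m : ℝ} (hr : 0 < r) (hr1 : r ≤ 1) (hx : 0 ≤ x) (hxy : x ≤ y)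
    (hym : y ≤ m) : r * m ^ (r - 1) * (y - x) ≤ y ^ r - x ^ r := by
  rcases (hx.trans hxy).eq_or_lt with rfl | hy
  · simp [le_antisymm hxy hx]
  have bernoulli : (x / y) ^ r ≤ 1 + r * (x / y - 1) := by
    simpa using rpow_one_add_le_one_add_mul_self (s := x / y - 1)
      (by linarith [div_nonneg hx hy.le]) hr.le hr1
  calc r * m ^ (r - 1) * (y - x) ≤ r * y ^ (r - 1) * (y - x) := by
        have := Real.rpow_le_rpow_of_nonpos hy hym (sub_nonpos.2 hr1)
        have := sub_nonneg.2 hxy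
        gcongr
    _ = y ^ r - y ^ r * (1 + r * (x / y - 1)) := by
        rw [Real.rpow_sub_one hy.ne']
        field_simp
        ring
    _ ≤ y ^ r - y ^ r * (x / y) ^ r := by gcongr
    _ = y ^ r - x ^ r := by rw [← Real.mul_rpow hy.le (by positivity), mul_div_cancel₀ _ hy.ne']

lemma mul_sub_le_dualityMap_sub {p m x y : ℝ} (hp1 : 1 < p) (hp2 : p ≤ 2) (hx : -m ≤ x)
    (hxy : x ≤ y) (hy : y ≤ m) :
    (p - 1) * m ^ (p - 2) * (y - x) ≤ dualityMap p y - dualityMap p x := by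
  have of_nonneg : ∀ {a b : ℝ}, 0 ≤ a → a ≤ b → b ≤ m →
      (p - 1) * m ^ (p - 2) * (b - a) ≤ dualityMap p b - dualityMap p a := fun {a b} ha hab hb => by
    rw [dualityMap_of_nonneg hp1.ne' ha, dualityMap_of_nonneg hp1.ne' (ha.trans hab),
      show p - 2 = p - 1 - 1 by ring]
    exact mul_sub_le_rpow_sub_rpow (sub_pos.2 hp1) (by linarith) ha hab hb
  have zero_eq : dualityMap p 0 = 0 := mul_zero _
  rcases le_total 0 x with hx0 | hx0
  · exact of_nonneg hx0 hxy hy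
  rcases le_total y 0 with hy0 | hy0
  · have := of_nonneg (neg_nonneg.2 hy0) (neg_le_neg hxy) (neg_le.1 hx)
    rw [dualityMap_neg, dualityMap_neg] at this
    linarith
  · have hpos := of_nonneg le_rfl hy0 hy
    have hneg := of_nonneg le_rfl (neg_nonneg.2 hx0) (neg_le.1 hx)
    rw [dualityMap_neg] at hneg
    linarith

lemma add_mul_sub_le_of_convexOn {S : Set ℝ} {f : ℝ → ℝ} {f' a b : ℝ} (hf : ConvexOn ℝ S f)
    (ha : a ∈ S) (hb : b ∈ S) (hf' : HasDerivAt f f' a) : f a + f' * (b - a) ≤ f b := by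
  rcases lt_trichotomy a b with hab | rfl | hab
  · have := hf.le_slope_of_hasDerivAt ha hb hab hf'
    rw [slope_def_field, le_div_iff₀ (sub_pos.2 hab)] at this
    linarith
  · simp
  · have := hf.slope_le_of_hasDerivAt hb ha hab hf'
    rw [slope_def_field, div_le_iff₀ (sub_pos.2 hab)] at this
    linarith

lemma mul_sq_sub_le_bregman {p m a b : ℝ} (hp1 : 1 < p) (hp2 : p ≤ 2) (ha : |a| ≤ m)
    (hb : |b| ≤ m) :
    p * (p - 1) / 2 * m ^ (p - 2) * (b - a) ^ 2 ≤
      |b| ^ p - |a| ^ p - p * dualityMap p a * (b - a) := by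
  set k := p * (p - 1) / 2 * m ^ (p - 2) with hk
  have hderiv : ∀ x : ℝ, HasDerivAt (fun x => |x| ^ p - k * x ^ 2)
      (p * dualityMap p x - 2 * k * x) x := fun x => by
    convert! (hasDerivAt_abs_rpow x hp1).sub ((hasDerivAt_pow 2 x).const_mul k) using 1
    rw [dualityMap]
    push_cast
    ring
  have hconv : ConvexOn ℝ (Set.Icc (-m) m) fun x : ℝ => |x| ^ p - k * x ^ 2 := by
    refine MonotoneOn.convexOn_of_deriv (convex_Icc _ _)
      (fun x _ => (hderiv x).continuousAt.continuousWithinAt)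
      (fun x _ => (hderiv x).differentiableAt.differentiableWithinAt) fun x hx y hy hxy => ?_
    rw [(hderiv x).deriv, (hderiv y).deriv]
    have hmono : 2 * k * (y - x) ≤ p * (dualityMap p y - dualityMap p x) :=
      calc 2 * k * (y - x) = p * ((p - 1) * m ^ (p - 2) * (y - x)) := by rw [hk]; ring
        _ ≤ p * (dualityMap p y - dualityMap p x) := by
          gcongr
          exact mul_sub_le_dualityMap_sub hp1 hp2 (interior_subset hx).1 hxy (interior_subset hy).2
    linarith
  have tangent := add_mul_sub_le_of_convexOn hconv (abs_le.1 ha) (abs_le.1 hb) (hderiv a)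
  linarith

lemma tsum_sq_sub_le_bregman {ι : Type*} {p m S : ℝ} {A B : ι → ℝ} (hp1 : 1 < p) (hp2 : p ≤ 2)
    (hm : 0 < m) (hA : ∀ i, |A i| ≤ m) (hB : ∀ i, |B i| ≤ m) (hAp : Summable fun i => |A i| ^ p)
    (hBp : Summable fun i => |B i| ^ p)
    (hS : HasSum (fun i => p * dualityMap p (A i) * (B i - A i)) S) :
    ∑' i, ENNReal.ofReal ((B i - A i) ^ 2) ≤ ENNReal.ofReal
      ((p * (p - 1) / 2 * m ^ (p - 2))⁻¹ * (∑' i, |B i| ^ p - ∑' i, |A i| ^ p - S)) := by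
  have hk : 0 < p * (p - 1) / 2 * m ^ (p - 2) := by
    have := sub_pos.2 hp1
    positivity
  have hsum := ((hBp.hasSum.sub hAp.hasSum).sub hS).mul_left (p * (p - 1) / 2 * m ^ (p - 2))⁻¹
  have hle : ∀ i, (B i - A i) ^ 2 ≤ (p * (p - 1) / 2 * m ^ (p - 2))⁻¹ *
      (|B i| ^ p - |A i| ^ p - p * dualityMap p (A i) * (B i - A i)) := fun i =>
    (le_inv_mul_iff₀ hk).2 (mul_sq_sub_le_bregman hp1 hp2 (hA i) (hB i))
  rw [← hsum.tsum_eq, ENNReal.ofReal_tsum_of_nonneg (fun i => (sq_nonneg _).trans (hle i))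
    hsum.summable]
  exact ENNReal.tsum_le_tsum fun i => ENNReal.ofReal_le_ofReal (hle i)

/-! ### Convergence rates -/

/-- `ξ` is the derivative at `u` of the penalty `‖·‖_{B^s_p}^p`: with the scaled coefficients
`A_λ` of `u`, the penalty is `∑_λ |A_λ|^p`, and its partial derivative in `⟨u, ψ_λ⟩` is
`p 2^{τ|λ|} |A_λ|^{p-2} A_λ` with `τ = s + d (1/2 - 1/p)`. -/
def IsPenaltyDerivative (W : WaveletSystem d) (s p : ℝ) (u ξ : Distr d) : Prop :=
  ∀ l, ξ (W.fn l) = p * (levelWeight (rateSmoothness d s p) l *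
    dualityMap p (scaledCoeff W (rateSmoothness d s p) u l))

lemma IsPenaltyDerivative.apply_fn_mul {s p : ℝ} {u ξ : Distr d}
    (hξ : IsPenaltyDerivative W s p u ξ) (h : Distr d) (l : Index d) :
    ξ (W.fn l) * h (W.fn l) = p * dualityMap p (scaledCoeff W (rateSmoothness d s p) u l) *
      scaledCoeff W (rateSmoothness d s p) h l := by
  rw [hξ, scaledCoeff, scaledCoeff]
  ring

theorem convergesAtRateSqrt_of_isPenaltyDerivative {sD pD s p : ℝ} {hpD : 0 < pD}
    {F : besov W sD pD hpD →ₗ[ℝ] L2 d}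
    (hF : ∃ C : ℝ≥0, ∀ u, ‖F u‖ₑ ≤ C * besovNorm W sD pD u) (hp1 : 1 < p) (hp2 : p ≤ 2)
    {u₀ : besov W sD pD hpD} {ξ : Distr d} (hξ : IsPenaltyDerivative W s p u₀ ξ)
    (hξF : ξ ∈ adjointRange F) :
    ConvergesAtRateSqrt W F s p (besovNorm W (rateSmoothness d s p) 2) u₀ := by
  have hp : 0 < p := one_pos.trans hp1
  obtain ⟨w, hw⟩ := exists_hasSum_of_mem_adjointRange hF hξF
  simp only [hξ.apply_fn_mul] at hw
  have hu₀ : besovPow W s p u₀ < ∞ := by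
    refine besovPow_lt_top_iff.2 (((hw u₀).summable.mul_left p⁻¹).congr fun l => ?_)
    rw [mul_assoc, dualityMap_mul_self hp.ne', inv_mul_cancel_left₀ hp.ne']
  refine convergesAtRateSqrt_of_le_bregman (w := w) hu₀ fun M => ?_
  set M' := max 1 (max M (besovPow W s p u₀).toReal)
  have hM' : 0 < M' := one_pos.trans_le (le_max_left _ _)
  have coeff_le : ∀ u : Distr d, besovPow W s p u ≤ ENNReal.ofReal M' →
      ∀ l, |scaledCoeff W (rateSmoothness d s p) u l| ≤ M' ^ p⁻¹ :=
    fun u => abs_scaledCoeff_le_of_besovPow_le hp hM'.le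
  refine ⟨(p * (p - 1) / 2 * (M' ^ p⁻¹) ^ (p - 2))⁻¹, ?_, fun u hu => ?_⟩
  · have := sub_pos.2 hp1
    positivity
  apply besovNorm_two_le_ofReal_sqrt
  rw [besovPow_eq_tsum_scaledCoeff, rateSmoothness_two, toReal_besovPow, toReal_besovPow,
    ← map_sub]
  simp only [Real.rpow_two, sq_abs, scaledCoeff_sub]
  have hu_finite := hu.trans_lt ENNReal.ofReal_lt_top
  refine tsum_sq_sub_le_bregman hp1 hp2 (by positivity) (coeff_le _ ?_)
    (coeff_le _ (hu.trans (ENNReal.ofReal_le_ofReal ?_))) (besovPow_lt_top_iff.1 hu₀)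
    (besovPow_lt_top_iff.1 hu_finite) ?_
  · rw [← ENNReal.ofReal_toReal hu₀.ne]
    exact ENNReal.ofReal_le_ofReal ((le_max_right _ _).trans (le_max_right _ _))
  · exact (le_max_left _ _).trans (le_max_right _ _)
  · simpa only [← scaledCoeff_sub, Submodule.coe_sub] using hw (u - u₀)

lemma rateSmoothness_penalty_le (d : ℕ) {sS pS sG pG sR : ℝ} (hpS : 0 < pS) (hpG : 0 < pG)
    (hsR : sR ≤ maxPenaltySmoothness sS pS sG pG) :
    pG * rateSmoothness d sG pG + (pS + pG) * rateSmoothness d sR (penaltyIntegrability pS pG) ≤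
      pS * rateSmoothness d sS pS := by
  rw [maxPenaltySmoothness, le_div_iff₀ (add_pos hpS hpG)] at hsR
  have hpS' : pS * rateSmoothness d sS pS = pS * sS + d * (pS / 2 - 1) := by
    rw [rateSmoothness]
    field_simp
  have hpG' : pG * rateSmoothness d sG pG = pG * sG + d * (pG / 2 - 1) := by
    rw [rateSmoothness]
    field_simp
  have hpR' : (pS + pG) * rateSmoothness d sR (penaltyIntegrability pS pG) =
      (pS + pG) * sR + d * ((pS + pG) / 2 - pG) := by
    rw [rateSmoothness, penaltyIntegrability]
    field_simp
  rw [hpS', hpG', hpR']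
  linarith

lemma abs_levelWeight_mul_dualityMap_rpow {p q r τ : ℝ} (hp : p ≠ 1) (hqr : q * (p - 1) = r)
    (u : Distr d) (l : Index d) :
    |levelWeight τ l * dualityMap p (scaledCoeff W τ u l)| ^ q =
      levelWeight ((r + q) * τ) l * |u (W.fn l)| ^ r := by
  have hw := (levelWeight_pos τ l).le
  have hu := abs_nonneg (u (W.fn l))
  calc |levelWeight τ l * dualityMap p (scaledCoeff W τ u l)| ^ q
      = (levelWeight τ l * (levelWeight τ l * |u (W.fn l)|) ^ (p - 1)) ^ q := by
        rw [abs_mul, abs_of_pos (levelWeight_pos τ l), abs_dualityMap hp, abs_scaledCoeff]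
    _ = levelWeight τ l ^ q * (levelWeight τ l ^ r * |u (W.fn l)| ^ r) := by
        rw [Real.mul_rpow hw (by positivity), ← Real.rpow_mul (by positivity), mul_comm (p - 1),
          hqr, Real.mul_rpow hw hu]
    _ = levelWeight ((r + q) * τ) l * |u (W.fn l)| ^ r := by
        rw [levelWeight_rpow, levelWeight_rpow, ← mul_assoc, ← levelWeight_add, ← add_mul,
          add_comm q]

lemma exists_isPenaltyDerivative_mem_besov {sS pS sG pG sR : ℝ} {hpS : 0 < pS} (hpG : 0 < pG)
    (hpG2 : pG ≤ 2) (hsG : 0 ≤ rateSmoothness d sG pG)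
    (hsR : sR ≤ maxPenaltySmoothness sS pS sG pG) {u : Distr d} (hu : u ∈ besov W sS pS hpS) :
    ∃ ξ ∈ besov W sG pG hpG, IsPenaltyDerivative W sR (penaltyIntegrability pS pG) u ξ := by
  have hpR : pG * (penaltyIntegrability pS pG - 1) = pS := by
    rw [penaltyIntegrability]
    field_simp
    ring
  have hpR1 : penaltyIntegrability pS pG ≠ 1 := fun h => hpS.ne' (by rw [← hpR, h]; ring)
  refine exists_mem_besov_apply_fn_eq hpG hpG2 hsG (((mem_besov_iff_summable.1 hu).2.mul_left
    (|penaltyIntegrability pS pG| ^ pG)).of_nonneg_of_le (fun l => by positivity) fun l => ?_)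
  rw [mul_left_comm, abs_mul, abs_mul, Real.mul_rpow (abs_nonneg _) (by positivity),
    Real.mul_rpow (abs_nonneg _) (abs_nonneg _), abs_levelWeight_mul_dualityMap_rpow hpR1 hpR,
    abs_of_pos (levelWeight_pos _ l), levelWeight_rpow, ← mul_assoc (levelWeight _ l),
    ← levelWeight_add, abs_scaledCoeff, Real.mul_rpow (levelWeight_pos _ l).le (abs_nonneg _),
    levelWeight_rpow]
  gcongr
  exact levelWeight_mono (rateSmoothness_penalty_le d hpS hpG hsR) l

theorem convergesAtRateSqrt_of_mem_besov {sD pD sS pS sG pG sR : ℝ} {hpD : 0 < pD} {hpS : 0 < pS}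
    {hpG : 0 < pG} {F : besov W sD pD hpD →ₗ[ℝ] L2 d}
    (hF : ∃ C : ℝ≥0, ∀ u, ‖F u‖ₑ ≤ C * besovNorm W sD pD u)
    (hrg : (besov W sG pG hpG : Set (Distr d)) ⊆ adjointRange F) (hpSG : pS ≤ pG) (hpG2 : pG ≤ 2)
    (hsG : 0 ≤ rateSmoothness d sG pG) (hsR : sR ≤ maxPenaltySmoothness sS pS sG pG)
    {u₀ : besov W sD pD hpD} (hu₀ : (u₀ : Distr d) ∈ besov W sS pS hpS) :
    ConvergesAtRateSqrt W F sR (penaltyIntegrability pS pG)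
      (besovNorm W (rateSmoothness d sR (penaltyIntegrability pS pG)) 2) u₀ := by
  obtain ⟨ξ, hξG, hξ⟩ := exists_isPenaltyDerivative_mem_besov hpG hpG2 hsG hsR hu₀
  refine convergesAtRateSqrt_of_isPenaltyDerivative hF ?_ ?_ hξ (hrg hξG)
  · rw [penaltyIntegrability, one_lt_div hpG]
    linarith
  · rw [penaltyIntegrability, div_le_iff₀ hpG]
    linarith

lemma isGreatest_guaranteedSmoothness (d : ℕ) (sS pS sG pG : ℝ) :
    IsGreatest (guaranteedSmoothness d sS pS sG pG)
      (rateSmoothness d (maxPenaltySmoothness sS pS sG pG) (penaltyIntegrability pS pG)) := by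
  refine ⟨⟨_, le_rfl, rfl⟩, ?_⟩
  rintro _ ⟨s, hs, rfl⟩
  exact add_le_add_left hs _

lemma penaltyIntegrability_self {p : ℝ} (hp : p ≠ 0) : penaltyIntegrability p p = 2 := by
  rw [penaltyIntegrability, ← two_mul, mul_div_cancel_right₀ _ hp]

lemma maxPenaltySmoothness_self (s p : ℝ) : maxPenaltySmoothness s p s p = 0 := by
  rw [maxPenaltySmoothness, sub_self, zero_div]

lemma isGreatest_guaranteedSmoothness_self_two (d : ℕ) (s : ℝ) :
    IsGreatest (guaranteedSmoothness d s 2 s 2) 0 := by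
  have hgreatest := isGreatest_guaranteedSmoothness d s 2 s 2
  rwa [penaltyIntegrability_self two_ne_zero, maxPenaltySmoothness_self, rateSmoothness_two]
    at hgreatest

theorem convergesAtRateSqrt_l2Norm_of_mem_sobolev {η : ℝ} (hη : 0 ≤ η)
    {F : sobolev W (-η) →ₗ[ℝ] L2 d} (hF : ∃ C : ℝ≥0, ∀ u, ‖F u‖ₑ ≤ C * besovNorm W (-η) 2 u)
    (hrg : (sobolev W η : Set (Distr d)) ⊆ adjointRange F) {u₀ : sobolev W (-η)}
    (hu₀ : (u₀ : Distr d) ∈ sobolev W η) : ConvergesAtRateSqrt W F 0 2 l2Norm u₀ := by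
  have hrate := convergesAtRateSqrt_of_mem_besov hF hrg le_rfl le_rfl
    (by rwa [rateSmoothness_two]) (maxPenaltySmoothness_self η 2).ge hu₀
  rw [penaltyIntegrability_self two_ne_zero, rateSmoothness_two] at hrate
  exact hrate.mono fun u => (u - u₀).2.1.besovNorm_zero_two.ge

lemma penaltyIntegrability_one_two : penaltyIntegrability 1 2 = 3 / 2 := by
  norm_num [penaltyIntegrability]

lemma maxPenaltySmoothness_one_two (s t : ℝ) : maxPenaltySmoothness s 1 t 2 = (s - 2 * t) / 3 := by
  rw [maxPenaltySmoothness]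
  ring

lemma rateSmoothness_three_halves (d : ℕ) (s : ℝ) : rateSmoothness d s (3 / 2) = s - d / 6 := by
  rw [rateSmoothness]
  ring

lemma isGreatest_guaranteedSmoothness_one_two (d : ℕ) (s t : ℝ) :
    IsGreatest (guaranteedSmoothness d s 1 t 2) ((s - 2 * t) / 3 - d / 6) := by
  have hgreatest := isGreatest_guaranteedSmoothness d s 1 t 2
  rwa [penaltyIntegrability_one_two, maxPenaltySmoothness_one_two, rateSmoothness_three_halves]
    at hgreatest

theorem convergesAtRateSqrt_of_mem_besov_one {η s sR : ℝ} (hη : 0 ≤ η)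
    {F : sobolev W (-η) →ₗ[ℝ] L2 d} (hF : ∃ C : ℝ≥0, ∀ u, ‖F u‖ₑ ≤ C * besovNorm W (-η) 2 u)
    (hrg : (sobolev W η : Set (Distr d)) ⊆ adjointRange F) (hsR : sR ≤ (s - 2 * η) / 3)
    {u₀ : sobolev W (-η)} (hu₀ : (u₀ : Distr d) ∈ besov W s 1 one_pos) :
    ConvergesAtRateSqrt W F sR (3 / 2) (besovNorm W (sR - d / 6) 2) u₀ := by
  have hrate := convergesAtRateSqrt_of_mem_besov hF hrg one_le_two le_rfl
    (by rwa [rateSmoothness_two]) (hsR.trans_eq (maxPenaltySmoothness_one_two s η).symm) hu₀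
  rwa [penaltyIntegrability_one_two, rateSmoothness_three_halves] at hrate

end BesovTikhonov

end

theorem mainTheorem6 (d : ℕ) (hd : 0 < d) (W : BesovTikhonov.WaveletSystem d)
    (η ε : ℝ) (hη : 0 < η) (hε : 0 < ε) (hεη : ε < η / 3)
    (F : BesovTikhonov.sobolev W (-η) →ₗ[ℝ] BesovTikhonov.L2 d)
    (hF : ∃ C : NNReal, ∀ u, ‖F u‖ₑ ≤ C * BesovTikhonov.besovNorm W (-η) 2 u)
    (hrg : BesovTikhonov.adjointRange F = (BesovTikhonov.sobolev W η : Set _)) :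
    -- the second source condition is strictly tighter than the first
    (BesovTikhonov.ContEmbeds W (η + d / 2 + 3 * ε) 1 one_pos η 2 two_pos ∧
      BesovTikhonov.besov W (η + d / 2 + 3 * ε) 1 one_pos < BesovTikhonov.sobolev W η) ∧
    -- the loose source space lies in the domain of `F`
    BesovTikhonov.ContEmbeds W η 2 two_pos (-η) 2 two_pos ∧
    -- `H^0` is `L_2`, with the same norm
    ((∀ u, u ∈ BesovTikhonov.sobolev W 0 ↔ BesovTikhonov.l2Norm u < ⊤) ∧
      ∀ u ∈ BesovTikhonov.sobolev W 0,
        BesovTikhonov.besovNorm W 0 2 u = BesovTikhonov.l2Norm u) ∧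
    -- `L_2 = H^0` is strictly smaller than the Sobolev space of the second rate
    (BesovTikhonov.ContEmbeds W 0 2 two_pos (-η / 3 + ε) 2 two_pos ∧
      BesovTikhonov.sobolev W 0 < BesovTikhonov.sobolev W (-η / 3 + ε)) ∧
    -- loose source condition: penalty of `L_2`, rate in `L_2`
    (BesovTikhonov.penaltyIntegrability 2 2 = 2 ∧
      BesovTikhonov.maxPenaltySmoothness η 2 η 2 = 0 ∧
      IsGreatest (BesovTikhonov.guaranteedSmoothness d η 2 η 2) 0 ∧
      ∀ u₀ : BesovTikhonov.sobolev W (-η),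
        (u₀ : BesovTikhonov.Distr d) ∈ BesovTikhonov.sobolev W η →
          BesovTikhonov.ConvergesAtRateSqrt W F 0 2 BesovTikhonov.l2Norm u₀) ∧
    -- tight source condition: penalty of `B^{-η/3+ε+d/6}_{3/2}`, rate in `H^{-η/3+ε}`
    (BesovTikhonov.penaltyIntegrability 1 2 = 3 / 2 ∧
      BesovTikhonov.maxPenaltySmoothness (η + d / 2 + 3 * ε) 1 η 2 = -η / 3 + ε + d / 6 ∧
      IsGreatest (BesovTikhonov.guaranteedSmoothness d (η + d / 2 + 3 * ε) 1 η 2)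
        (-η / 3 + ε) ∧
      ∀ u₀ : BesovTikhonov.sobolev W (-η),
        (u₀ : BesovTikhonov.Distr d) ∈
            BesovTikhonov.besov W (η + d / 2 + 3 * ε) 1 one_pos →
          BesovTikhonov.ConvergesAtRateSqrt W F (-η / 3 + ε + d / 6) (3 / 2)
            (BesovTikhonov.besovNorm W (-η / 3 + ε) 2) u₀) := by
  have hd' : (0 : ℝ) < d := Nat.cast_pos.2 hd
  have hsR : (η + d / 2 + 3 * ε - 2 * η) / 3 = -η / 3 + ε + d / 6 := by ring
  have hσ : -η / 3 + ε + d / 6 - (d : ℝ) / 6 = -η / 3 + ε := add_sub_cancel_right _ _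
  have hσ_tight :=
    BesovTikhonov.isGreatest_guaranteedSmoothness_one_two d (η + d / 2 + 3 * ε) η
  rw [hsR, hσ] at hσ_tight
  have hrate_tight := fun u₀ =>
    BesovTikhonov.convergesAtRateSqrt_of_mem_besov_one (u₀ := u₀) hη.le hF hrg.ge hsR.ge
  rw [hσ] at hrate_tight
  refine ⟨⟨BesovTikhonov.contEmbeds_of_rateSmoothness_le _ _ one_le_two ?_,
      BesovTikhonov.besov_lt_besov W hd _ _ one_le_two ?_ ?_⟩,
    BesovTikhonov.contEmbeds_of_rateSmoothness_le _ _ le_rfl ?_,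
    ⟨fun _ => BesovTikhonov.mem_sobolev_zero_iff_l2Norm_lt_top,
      fun _ hu => hu.1.besovNorm_zero_two⟩,
    ⟨BesovTikhonov.contEmbeds_of_rateSmoothness_le _ _ le_rfl ?_,
      BesovTikhonov.besov_lt_besov W hd _ _ le_rfl ?_ ?_⟩,
    ⟨BesovTikhonov.penaltyIntegrability_self two_ne_zero,
      BesovTikhonov.maxPenaltySmoothness_self η 2,
      BesovTikhonov.isGreatest_guaranteedSmoothness_self_two d η,
      fun _ => BesovTikhonov.convergesAtRateSqrt_l2Norm_of_mem_sobolev hη.le hF hrg.ge⟩,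
    ⟨BesovTikhonov.penaltyIntegrability_one_two,
      (BesovTikhonov.maxPenaltySmoothness_one_two _ η).trans hsR, hσ_tight, hrate_tight⟩⟩
  all_goals
    simp only [BesovTikhonov.rateSmoothness_one, BesovTikhonov.rateSmoothness_two]
    linarith
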